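/- Let $T=\mathbb Z$ or $T=\mathbb R$, and let $T^*=[-\pi,\pi]$ if $T=\mathbb Z$ and $T^*=\mathbb R$ if $T=\mathbb R$. For all $a,m,M>0$ there exists a constant $C=C(a,m,M)>0$ with the following property. Let $f:T\to\mathbb R$ be a Gaussian stationary process (all finite marginals $(f(t_1),\dots,f(t_n))$ are multivariate Gaussian and their laws are invariant under shifts by elements of $T$; in case $T=\mathbb R$ the paths of $f$ are, moreover, almost surely continuous). Let $\rho$ be its spectral measure, that is, a finite non-negative measure on $T^*$ such that $$\mathbb E[f(0)f(t)]=\int_{T^*}e^{-i\lambda t}\,d\rho(\lambda)\qquad\text{for all }t\in T,$$ and suppose that $\int_{T^*}|\lambda|^\delta\,d\rho(\lambda)<\infty$ for some $\delta>0$, and that $$m|I|\le\rho(I)\le M|I|\qquad\text{for every interval } I\subset(-a,a)\cap T^*,$$ where $|I|$ is the length of $I$. Then there is $N_0$ (which may depend on $f$) such that for all real $N\ge N_0$, $$H_f(N):=\mathbb P\bigl(f(t)>0\text{ for all }t\in[0,N)\cap T\bigr)\le e^{-CN}.$$ -/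

import Mathlib

open MeasureTheory ProbabilityTheory Filter

noncomputable section

namespace GaussianPersistence

/-- A time set `T` with its inclusion into `ℝ`, and with its dual `T*` as a subset of `ℝ`.
It is used only for the two instances below. -/
class TimeSet (T : Type) where
  toReal : T → ℝ
  dual : Set ℝ

/-- `T = ℤ`, with dual `[-π, π]`. -/
instance : TimeSet ℤ where
  toReal n := (n : ℝ)
  dual := Set.Icc (-Real.pi) Real.pi

/-- `T = ℝ`, with dual `ℝ`. -/
instance : TimeSet ℝ where
  toReal t := t
  dual := Set.univ

variable {Ω : Type*} [MeasurableSpace Ω] {T : Type}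

/-- A Gaussian stationary process on `T`: all finite marginals are (possibly degenerate) Gaussian
vectors, the finite marginals are invariant under all shifts by elements of `T`, and almost every
path is continuous (no restriction for the discrete space `ℤ`). -/
structure IsGaussianStationary [AddCommGroup T] [TopologicalSpace T]
    (f : T → Ω → ℝ) (P : Measure Ω) : Prop where
  gaussian : IsGaussianProcess f P
  stationary : ∀ (s : T) (n : ℕ) (t : Fin n → T),
    IdentDistrib (fun ω i => f (t i + s) ω) (fun ω i => f (t i) ω) P P
  continuous_paths : ∀ᵐ ω ∂P, Continuous fun t => f t ω

/-- The covariance function `r(t) = E[f(0) f(t)]`. -/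
def covarianceFn [Zero T] (f : T → Ω → ℝ) (P : Measure Ω) (t : T) : ℝ :=
  ∫ ω, f 0 ω * f t ω ∂P

/-- `ρ` is a spectral measure of `f`: a finite measure on `T*` (regarded as a measure on `ℝ`
carried by `T*`) with `r(t) = ∫ exp(-iλt) dρ(λ)` for all `t ∈ T`. -/
structure IsSpectralMeasure [Zero T] [TimeSet T]
    (f : T → Ω → ℝ) (P : Measure Ω) (ρ : Measure ℝ) : Prop where
  finite : IsFiniteMeasure ρ
  carried : ρ (TimeSet.dual T)ᶜ = 0
  fourier : ∀ t : T, (covarianceFn f P t : ℂ) =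
    ∫ l : ℝ, Complex.exp (-(Complex.I * (l : ℂ) * (TimeSet.toReal t : ℂ))) ∂ρ

/-- The moment condition: `∫ |λ|^δ dρ(λ) < ∞` for some `δ > 0`. -/
def MomentCondition (ρ : Measure ℝ) : Prop :=
  ∃ δ : ℝ, 0 < δ ∧ ∫⁻ l : ℝ, ENNReal.ofReal (|l| ^ δ) ∂ρ < ⊤

/-- `m |I| ≤ ρ(I) ≤ M |I|` for every interval `I ⊆ (-a, a)` of the dual of `T`. -/
def ComparableNearZero (T : Type) [TimeSet T] (ρ : Measure ℝ) (a m M : ℝ) : Prop :=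
  ∀ I : Set ℝ, I.OrdConnected → I ⊆ Set.Ioo (-a) a ∩ TimeSet.dual T →
    ENNReal.ofReal m * volume I ≤ ρ I ∧ ρ I ≤ ENNReal.ofReal M * volume I

/-- The gap (persistence) probability `H_f(N) = P(f(t) > 0 for all t ∈ [0, N) ∩ T)`. -/
def gapProbability [TimeSet T] (f : T → Ω → ℝ) (P : Measure Ω) (N : ℝ) : ℝ :=
  P.real {ω | ∀ t : T, TimeSet.toReal t ∈ Set.Ico 0 N → 0 < f t ω}

end GaussianPersistence

end

/-! Fix an integer `d` with `π / d ≤ a`, so that the spectral measure is comparable to length on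
`(-π / d, π / d)`, and sample at step `1 / p` over a time window of length `n * d ≈ N`. The
persistence event is split according to whether the average of the samples exceeds a constant `K`
depending only on `d` and `m`.

Large average: the upper bound `M` near frequency zero, tested against a Fejér-type kernel, makes
the variance of the average `O(1 / N)` (`integral_trigEnergy_average_le`), so the Gaussian tail is
exponentially small in `N`.

Small average: the samples split into `d * p` progressions of time step `d`, each with `n` points.
By Parseval on `(-π / d, π / d)`, the lower bound `m` forces the covariance along each progression
to dominate a multiple of the identity, hence the joint density is at most a constant to the power
`n` (`lintegral_prod_le_of_variance_ge`). Integrating `exp (-α * ∑ x j)` over the positive orthant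
gives at most `exp (-2 * n)` for `α = 1 / K`. By Jensen, a small average makes the mean of these
weights over the progressions at least `exp (-n)`, and Markov leaves `exp (-n)`
(`measure_pos_and_average_le`).

Neither estimate involves `p` except through the spectral mass beyond `π * p`. Thus `p` may be
chosen after `N` to make that mass negligible, at no cost in the rate. -/

namespace GaussianPersistence

/-! ### Density and tail bounds for Gaussian vectors; comparison of measures on the line -/

/-- A Gaussian measure whose covariance dominates `c • 1` is the convolution of a product of
centred real Gaussians of variance `c` and another probability measure. -/
lemma exists_conv_eq_of_covarianceBilin_ge {ι : Type*} [Fintype ι]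
    (μ : Measure (EuclideanSpace ℝ ι)) [IsGaussian μ] (c : NNReal)
    (h : ∀ x, c * ‖x‖ ^ 2 ≤ covarianceBilin μ x x) :
    ∃ ν : Measure (EuclideanSpace ℝ ι), IsProbabilityMeasure ν ∧
      μ = ((Measure.pi fun _ : ι ↦ gaussianReal 0 c).map (WithLp.toLp 2)) ∗ ν := by
  classical
  set e := EuclideanSpace.basisFun ι ℝ
  let S : Matrix ι ι ℝ := Matrix.of fun i j ↦ covarianceBilin μ (e i) (e j)
  have hquad : ∀ x : EuclideanSpace ℝ ι, x.ofLp ⬝ᵥ S.mulVec x.ofLp = covarianceBilin μ x x := by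
    intro x
    conv_rhs => rw [← e.sum_repr x]
    simp only [map_sum, map_smul, sum_apply, smul_apply,
      smul_eq_mul, dotProduct, Matrix.mulVec, S, Matrix.of_apply, e, EuclideanSpace.basisFun_repr,
      Finset.mul_sum]
    rw [Finset.sum_comm]
    exact Finset.sum_congr rfl fun i _ ↦ Finset.sum_congr rfl fun j _ ↦ by ring
  have hself : ∀ x : EuclideanSpace ℝ ι, x.ofLp ⬝ᵥ x.ofLp = ‖x‖ ^ 2 := fun x ↦ by
    rw [EuclideanSpace.real_norm_sq_eq]
    exact Finset.sum_congr rfl fun i _ ↦ (sq _).symm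
  have hdiff : ∀ x : EuclideanSpace ℝ ι,
      x.ofLp ⬝ᵥ (S - (c : ℝ) • 1).mulVec x.ofLp = covarianceBilin μ x x - c * ‖x‖ ^ 2 := by
    intro x
    rw [Matrix.sub_mulVec, dotProduct_sub, hquad, Matrix.smul_mulVec, Matrix.one_mulVec,
      dotProduct_smul, hself, smul_eq_mul]
  have hpsd : (S - (c : ℝ) • 1).PosSemidef := by
    refine .of_dotProduct_mulVec_nonneg ?_ fun x ↦ ?_
    · refine Matrix.IsHermitian.sub ?_ ?_
      · ext i j
        simp [S, covarianceBilin_comm (e i)]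
      · ext i j
        simp [Matrix.one_apply, eq_comm]
    · have := hdiff (WithLp.toLp 2 x)
      simp only [star_trivial]
      rw [this]
      exact sub_nonneg.2 (h _)
  -- The second factor carries the mean and the remaining covariance, which may be singular;
  -- characteristic functions then multiply to that of `μ`.
  refine ⟨multivariateGaussian (∫ x, x ∂μ) (S - (c : ℝ) • 1), inferInstance, ?_⟩
  have : IsProbabilityMeasure ((Measure.pi fun _ : ι ↦ gaussianReal 0 c).map (WithLp.toLp 2)) :=
    Measure.isProbabilityMeasure_map (by fun_prop)
  apply Measure.ext_of_charFun
  ext t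
  rw [charFun_conv, charFun_multivariateGaussian hpsd, hdiff, charFun_pi, IsGaussian.charFun_eq']
  simp_rw [charFun_gaussianReal, ← Complex.exp_sum, ← Complex.exp_add]
  congr 1
  simp only [id, Complex.ofReal_zero, mul_zero, zero_mul, zero_sub, Finset.sum_neg_distrib,
    ← Finset.sum_div, ← Finset.mul_sum]
  have : (∑ i, ((t i : ℝ) : ℂ) ^ 2) = ((‖t‖ ^ 2 : ℝ) : ℂ) := by
    rw [EuclideanSpace.real_norm_sq_eq]; push_cast; rfl
  rw [this]
  push_cast
  ring

lemma lintegral_gaussianReal_le (μ : ℝ) {v : NNReal} (hv : v ≠ 0) (F : ℝ → ENNReal) :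
    ∫⁻ x, F x ∂(gaussianReal μ v) ≤
      ENNReal.ofReal (√(2 * Real.pi * v))⁻¹ * ∫⁻ x, F x := by
  rw [gaussianReal_of_var_ne_zero μ hv,
    lintegral_withDensity_eq_lintegral_mul_non_measurable _ (measurable_gaussianPDF μ v)
      (.of_forall fun _ ↦ ENNReal.ofReal_lt_top),
    ← lintegral_const_mul' _ _ ENNReal.ofReal_ne_top]
  refine lintegral_mono fun x ↦ ?_
  simp only [Pi.mul_apply, gaussianPDF, gaussianPDFReal]
  gcongr
  refine mul_le_of_le_one_right (by positivity) (Real.exp_le_one_iff.2 ?_)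
  exact div_nonpos_of_nonpos_of_nonneg (neg_nonpos.2 (sq_nonneg _)) (by positivity)

lemma lintegral_pi_prod_gaussianReal_le {ι : Type*} [Fintype ι] {v : NNReal} (hv : v ≠ 0)
    {F : ℝ → ENNReal} (hF : Measurable F) (y : ι → ℝ) :
    ∫⁻ x, ∏ i, F (x i + y i) ∂(Measure.pi fun _ : ι ↦ gaussianReal 0 v) ≤
      (ENNReal.ofReal (√(2 * Real.pi * v))⁻¹ * ∫⁻ x, F x) ^ Fintype.card ι := by
  have hm : ∀ i, Measurable fun x ↦ F (x + y i) := fun i ↦ by fun_prop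
  have hind := iIndepFun_pi (μ := fun _ : ι ↦ gaussianReal 0 v) (X := fun i x ↦ F (x + y i))
    fun i ↦ (hm i).aemeasurable
  rw [lintegral_prod_eq_prod_lintegral_of_indepFun Finset.univ _ hind fun i ↦ by fun_prop]
  rw [Fintype.card, ← Finset.prod_const]
  refine Finset.prod_le_prod' fun i _ ↦ ?_
  have h1 : ∫⁻ x, F (x i + y i) ∂(Measure.pi fun _ : ι ↦ gaussianReal 0 v) =
      ∫⁻ x, F (x + y i) ∂(gaussianReal 0 v) :=
    (measurePreserving_eval (fun _ : ι ↦ gaussianReal 0 v) i).lintegral_comp (hm i)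
  -- Translation invariance of Lebesgue measure makes the bound uniform in the shift `y`.
  rw [h1, ← lintegral_add_right_eq_self F (y i)]
  exact lintegral_gaussianReal_le 0 hv _

/-- If every linear combination of the Gaussian vector `Y` has variance at least `c` times the
squared norm of its coefficients, then the density of `Y` is at most `(2πc)^(-n/2)`; here tested
against product functions. -/
lemma lintegral_prod_le_of_variance_ge {Ω ι : Type*} [MeasurableSpace Ω] {P : Measure Ω}
    [Fintype ι] {Y : ι → Ω → ℝ} (hY : HasGaussianLaw (fun ω ↦ (Y · ω)) P) {c : NNReal} (hc : c ≠ 0)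
    (hvar : ∀ a : ι → ℝ, c * ∑ i, a i ^ 2 ≤ Var[fun ω ↦ ∑ i, a i * Y i ω; P])
    {F : ℝ → ENNReal} (hF : Measurable F) :
    ∫⁻ ω, ∏ i, F (Y i ω) ∂P ≤
      (ENNReal.ofReal (√(2 * Real.pi * c))⁻¹ * ∫⁻ x, F x) ^ Fintype.card ι := by
  have hY2 := hY.toLp_pi 2
  have hP : IsProbabilityMeasure P := hY.isProbabilityMeasure
  have := hY2.isGaussian_map
  set μ := P.map (fun ω ↦ WithLp.toLp 2 (Y · ω)) with hμ
  obtain ⟨ν, hν, hconv⟩ := exists_conv_eq_of_covarianceBilin_ge μ c fun x ↦ by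
    rw [covarianceBilin_self IsGaussian.memLp_two_id, hμ, variance_map (by fun_prop)
      hY2.aemeasurable, EuclideanSpace.real_norm_sq_eq]
    convert hvar x using 2
    ext ω
    simp [PiLp.inner_apply, mul_comm]
  have hG : Measurable fun x : EuclideanSpace ℝ ι ↦ ∏ i, F (x i) := by fun_prop
  have h1 : ∫⁻ ω, ∏ i, F (Y i ω) ∂P = ∫⁻ x, ∏ i, F (x i) ∂μ := by
    rw [hμ, lintegral_map' hG.aemeasurable hY2.aemeasurable]
  rw [h1, hconv, Measure.conv_comm, Measure.lintegral_conv hG]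
  calc _ ≤ ∫⁻ y, (ENNReal.ofReal (√(2 * Real.pi * c))⁻¹ * ∫⁻ x, F x) ^ Fintype.card ι ∂ν := by
        refine lintegral_mono fun y ↦ ?_
        rw [lintegral_map (by fun_prop) (by fun_prop)]
        refine le_trans (le_of_eq ?_) (lintegral_pi_prod_gaussianReal_le hc hF y)
        simp [add_comm]
    _ = _ := by simp

/-- Chernoff's bound with parameter `K / V`, the optimal one for variance exactly `V`; a smaller,
even zero, variance only improves it. -/
lemma measureReal_ge_le_of_variance_le {Ω : Type*} [MeasurableSpace Ω] {P : Measure Ω}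
    {Y : Ω → ℝ} (hY : HasGaussianLaw Y P) (hmean : P[Y] = 0) {V K : ℝ} (hV : 0 < V) (hK : 0 ≤ K)
    (hvar : Var[Y; P] ≤ V) :
    P.real {ω | K ≤ Y ω} ≤ Real.exp (-(K ^ 2 / (2 * V))) := by
  have hP : IsProbabilityMeasure P := hY.isProbabilityMeasure
  have hmap := hY.map_eq_gaussianReal
  have hI : Integrable (fun ω ↦ Real.exp (K / V * Y ω)) P := by
    have := integrable_exp_mul_gaussianReal (μ := P[Y]) (v := Var[Y; P].toNNReal) (K / V)
    rw [← hmap] at this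
    exact this.comp_aemeasurable hY.aemeasurable
  refine (measure_ge_le_exp_mul_mgf K (div_nonneg hK hV.le) hI).trans ?_
  rw [mgf_gaussianReal hmap, ← Real.exp_add, hmean, Real.exp_le_exp,
    Real.coe_toNNReal _ (variance_nonneg _ _)]
  have : Var[Y; P] * (K / V) ^ 2 / 2 ≤ V * (K / V) ^ 2 / 2 := by gcongr
  refine (add_le_add_right (add_le_add_right this _) _).trans (le_of_eq ?_)
  field_simp
  ring

/-- By the Besicovitch covering theorem, comparison on small closed balls around every point of an
open set passes to all its Borel subsets. -/
lemma restrict_le_restrict_of_forall_closedBall_le {μ ν : Measure ℝ} [SFinite μ]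
    [IsLocallyFiniteMeasure ν] {U : Set ℝ} (hU : IsOpen U)
    (h : ∀ x r, Metric.closedBall x r ⊆ U → μ (Metric.closedBall x r) ≤ ν (Metric.closedBall x r)) :
    μ.restrict U ≤ ν.restrict U := by
  refine Measure.le_iff.2 fun s hs ↦ ?_
  rw [Measure.restrict_apply hs, Measure.restrict_apply hs]
  refine (Besicovitch.vitaliFamily μ).measure_le_of_frequently_le ν .rfl _ fun x hx ↦ ?_
  refine (Besicovitch.tendsto_filterAt μ x).frequently (Eventually.frequently ?_)
  obtain ⟨ε, hε, hball⟩ := Metric.isOpen_iff.1 hU x hx.2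
  filter_upwards [Ioo_mem_nhdsGT hε] with r hr
  exact h x r ((Metric.closedBall_subset_ball hr.2).trans hball)

/-! ### Trigonometric polynomials integrated against the spectral measure -/

section TrigEnergy

variable {ι : Type*} [Fintype ι]

/-- The squared modulus of the trigonometric polynomial `∑ j, a j * exp (i l t j)`. -/
noncomputable def trigEnergy (a t : ι → ℝ) (l : ℝ) : ℝ :=
  ‖∑ j, (a j : ℂ) * Complex.exp (↑(l * t j) * Complex.I)‖ ^ 2

lemma trigEnergy_nonneg (a t : ι → ℝ) (l : ℝ) : 0 ≤ trigEnergy a t l := sq_nonneg _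

lemma trigEnergy_eq_sum (a t : ι → ℝ) (l : ℝ) :
    trigEnergy a t l = ∑ i, ∑ j, a i * a j * Real.cos (l * (t i - t j)) := by
  have hre : (∑ j, (a j : ℂ) * Complex.exp (↑(l * t j) * Complex.I)).re =
      ∑ j, a j * Real.cos (l * t j) := by
    simp only [Complex.re_sum, Complex.re_ofReal_mul, Complex.exp_ofReal_mul_I_re]
  have him : (∑ j, (a j : ℂ) * Complex.exp (↑(l * t j) * Complex.I)).im =
      ∑ j, a j * Real.sin (l * t j) := by
    simp only [Complex.im_sum, Complex.im_ofReal_mul, Complex.exp_ofReal_mul_I_im]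
  rw [trigEnergy, ← Complex.normSq_eq_norm_sq, Complex.normSq_apply, hre, him,
    Finset.sum_mul_sum, Finset.sum_mul_sum, ← Finset.sum_add_distrib]
  refine Finset.sum_congr rfl fun i _ ↦ ?_
  rw [← Finset.sum_add_distrib]
  refine Finset.sum_congr rfl fun j _ ↦ ?_
  rw [mul_sub, Real.cos_sub]
  ring

lemma integrable_cos_mul (ρ : Measure ℝ) [IsFiniteMeasure ρ] (s : ℝ) :
    Integrable (fun l ↦ Real.cos (l * s)) ρ :=
  Integrable.of_bound (by fun_prop : Continuous _).aestronglyMeasurable 1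
    (.of_forall fun l ↦ by simpa using Real.abs_cos_le_one _)

lemma integrable_trigEnergy (ρ : Measure ℝ) [IsFiniteMeasure ρ] (a t : ι → ℝ) :
    Integrable (trigEnergy a t) ρ := by
  rw [funext (trigEnergy_eq_sum a t)]
  exact integrable_finsetSum _ fun i _ ↦ integrable_finsetSum _ fun j _ ↦
    (integrable_cos_mul ρ _).const_mul _

/-- The isometry between linear combinations of the process and trigonometric polynomials. -/
lemma integral_sq_sum_eq_integral_trigEnergy {Ω : Type*} [MeasurableSpace Ω] {P : Measure Ω}
    {ρ : Measure ℝ} [IsFiniteMeasure ρ] {X : ι → Ω → ℝ} {t : ι → ℝ} (hX : ∀ i, MemLp (X i) 2 P)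
    (hcov : ∀ i j, ∫ ω, X i ω * X j ω ∂P = ∫ l, Real.cos (l * (t i - t j)) ∂ρ) (a : ι → ℝ) :
    ∫ ω, (∑ i, a i * X i ω) ^ 2 ∂P = ∫ l, trigEnergy a t l ∂ρ := by
  have h1 : ∀ ω, (∑ i, a i * X i ω) ^ 2 = ∑ i, ∑ j, a i * a j * (X i ω * X j ω) := fun ω ↦ by
    rw [sq, Finset.sum_mul_sum]
    exact Finset.sum_congr rfl fun i _ ↦ Finset.sum_congr rfl fun j _ ↦ by ring
  have hI : ∀ i j, Integrable (fun ω ↦ a i * a j * (X i ω * X j ω)) P := fun i j ↦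
    ((hX i).integrable_mul (hX j)).const_mul _
  have hI_cos : ∀ i j, Integrable (fun l ↦ a i * a j * Real.cos (l * (t i - t j))) ρ := fun i j ↦
    (integrable_cos_mul ρ _).const_mul _
  simp_rw [h1, trigEnergy_eq_sum]
  rw [integral_finsetSum _ fun i _ ↦ integrable_finsetSum _ fun j _ ↦ hI i j,
    integral_finsetSum _ fun i _ ↦ integrable_finsetSum _ fun j _ ↦ hI_cos i j]
  refine Finset.sum_congr rfl fun i _ ↦ ?_
  rw [integral_finsetSum _ fun j _ ↦ hI i j, integral_finsetSum _ fun j _ ↦ hI_cos i j]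
  refine Finset.sum_congr rfl fun j _ ↦ ?_
  rw [integral_const_mul, integral_const_mul, hcov]

/-- Parseval's identity for points in an arithmetic progression of step `d`. -/
lemma integral_trigEnergy_arithmetic {n : ℕ} (a : Fin n → ℝ) (s : ℝ) {d : ℝ} (hd : 0 < d) :
    ∫ l in Set.Ioo (-(Real.pi / d)) (Real.pi / d), trigEnergy a (fun j ↦ s + j * d) l =
      2 * (Real.pi / d) * ∑ j, a j ^ 2 := by
  have hπd : 0 < Real.pi / d := div_pos Real.pi_pos hd
  have hcos : ∀ i j : Fin n, ∫ l in Set.Ioo (-(Real.pi / d)) (Real.pi / d),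
      Real.cos (l * ((s + i * d) - (s + j * d))) = if i = j then 2 * (Real.pi / d) else 0 := by
    intro i j
    rw [← integral_Ioc_eq_integral_Ioo, ← intervalIntegral.integral_of_le (by linarith)]
    split_ifs with hij
    · subst hij
      simp
      ring
    · have hne : ((i : ℝ) - j) * d ≠ 0 := by
        refine mul_ne_zero (sub_ne_zero.2 ?_) hd.ne'
        exact_mod_cast fun h ↦ hij (Fin.ext h)
      have : ∀ l : ℝ, l * ((s + i * d) - (s + j * d)) = l * (((i : ℝ) - j) * d) := fun l ↦ by ring
      simp_rw [this]
      rw [intervalIntegral.integral_comp_mul_right _ hne, integral_cos]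
      -- The endpoints of the interval become integer multiples of `π`, where the sine vanishes:
      -- this is orthogonality.
      have hz : Real.pi / d * (((i : ℝ) - j) * d) = ((i - j : ℤ) : ℝ) * Real.pi := by
        field_simp
        push_cast
        ring
      rw [neg_mul, hz, Real.sin_neg, Real.sin_int_mul_pi]
      simp
  have hI : ∀ i j : Fin n, Integrable (fun l ↦ a i * a j *
      Real.cos (l * ((s + i * d) - (s + j * d))))
      (volume.restrict (Set.Ioo (-(Real.pi / d)) (Real.pi / d))) := fun i j ↦
    (integrable_cos_mul _ _).const_mul _
  simp_rw [trigEnergy_eq_sum]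
  rw [integral_finsetSum _ fun i _ ↦ integrable_finsetSum _ fun j _ ↦ hI i j, Finset.mul_sum]
  refine Finset.sum_congr rfl fun i _ ↦ ?_
  rw [integral_finsetSum _ fun j _ ↦ hI i j]
  simp_rw [integral_const_mul, hcos]
  simp
  ring

end TrigEnergy

lemma trigEnergy_average_le_one {k : ℕ} (hk : 0 < k) (t : Fin k → ℝ) (l : ℝ) :
    trigEnergy (fun _ ↦ (k : ℝ)⁻¹) t l ≤ 1 := by
  have hk' : (0 : ℝ) < k := by exact_mod_cast hk
  refine pow_le_one₀ (norm_nonneg _) ((norm_sum_le _ _).trans (le_of_eq ?_))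
  simp [Complex.norm_exp_ofReal_mul_I, hk'.ne', -Complex.ofReal_mul]

/-- The Fejér-type bound for the average over `k` points of step `1 / p`. -/
lemma trigEnergy_average_le {k p : ℕ} (hk : 0 < k) (hp : 0 < p) {l : ℝ} (hl : |l| ≤ Real.pi * p) :
    trigEnergy (fun _ : Fin k ↦ (k : ℝ)⁻¹) (fun j ↦ (j : ℝ) / p) l ≤
      2 * (1 + (k / p / Real.pi * l) ^ 2)⁻¹ := by
  have hk' : (0 : ℝ) < k := by exact_mod_cast hk
  have hp' : (0 : ℝ) < p := by exact_mod_cast hp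
  have hπ := Real.pi_pos
  have h1 := trigEnergy_average_le_one hk (fun j ↦ (j : ℝ) / p) l
  set E := trigEnergy (fun _ : Fin k ↦ (k : ℝ)⁻¹) (fun j ↦ (j : ℝ) / p) l with hE
  -- Adding `E ≤ 1` to this bound gives `E * (1 + x ^ 2) ≤ 2`, a majorant integrable over the whole
  -- line.
  suffices h2 : E * (k / p / Real.pi * l) ^ 2 ≤ 1 by
    rw [← div_eq_mul_inv, le_div_iff₀ (by positivity)]
    linarith
  set z : ℂ := Complex.exp (Complex.I * ↑(l / p)) with hz
  have hsum : ∑ j : Fin k, (((k : ℝ)⁻¹ : ℝ) : ℂ) * Complex.exp (↑(l * ((j : ℝ) / p)) * Complex.I) =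
      (k : ℂ)⁻¹ * ∑ j ∈ Finset.range k, z ^ j := by
    rw [← Finset.mul_sum, Finset.sum_range]
    push_cast
    congr 1
    refine Finset.sum_congr rfl fun j _ ↦ ?_
    rw [hz, ← Complex.exp_nat_mul]
    congr 1
    push_cast
    ring
  have hzn : ‖z‖ = 1 := by rw [hz, mul_comm]; exact Complex.norm_exp_ofReal_mul_I _
  have hgeom : ‖∑ j ∈ Finset.range k, z ^ j‖ * ‖z - 1‖ ≤ 2 := by
    rw [← norm_mul, geom_sum_mul]
    refine (norm_sub_le _ _).trans ?_
    rw [norm_pow, hzn]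
    norm_num
  -- Jordan's inequality for the sine, available because `|l| / (2 * p) ≤ π / 2`.
  have hz1 : 2 * |l| / (Real.pi * p) ≤ ‖z - 1‖ := by
    rw [hz, Complex.norm_exp_I_mul_ofReal_sub_one, norm_mul, Real.norm_ofNat, Real.norm_eq_abs]
    have := Real.mul_abs_le_abs_sin (x := l / p / 2) (by
      rw [abs_div, abs_div, abs_of_pos hp', abs_two]
      rw [div_le_div_iff_of_pos_right two_pos, div_le_iff₀ hp']
      exact hl)
    rw [abs_div, abs_div, abs_of_pos hp', abs_two] at this
    refine le_trans (le_of_eq ?_) (mul_le_mul_of_nonneg_left this two_pos.le)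
    field_simp
  have hG : ‖∑ j ∈ Finset.range k, z ^ j‖ * (|l| / (Real.pi * p)) ≤ 1 := by
    have := (mul_le_mul_of_nonneg_left hz1 (norm_nonneg (∑ j ∈ Finset.range k, z ^ j))).trans hgeom
    rw [mul_div_assoc] at this
    linarith
  have : E * (k / p / Real.pi * l) ^ 2 =
      (‖∑ j ∈ Finset.range k, z ^ j‖ * (|l| / (Real.pi * p))) ^ 2 := by
    rw [hE, trigEnergy, hsum, norm_mul, norm_inv, Complex.norm_natCast, mul_pow, mul_pow, mul_pow,
      div_pow |l|, sq_abs]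
    field_simp
  rw [this]
  exact pow_le_one₀ (by positivity) hG

/-- The variance of averages: the contribution of the frequencies near zero, of the intermediate
ones, and of the ones beyond the sampling frequency. -/
lemma integral_trigEnergy_average_le {ρ : Measure ℝ} [IsFiniteMeasure ρ] {b M : ℝ} (hb : 0 < b)
    (hM : 0 ≤ M) (hρ : ρ.restrict (Set.Ioo (-b) b) ≤
      (ENNReal.ofReal M • volume).restrict (Set.Ioo (-b) b))
    {k p : ℕ} (hk : 0 < k) (hp : 0 < p) :
    ∫ l, trigEnergy (fun _ : Fin k ↦ (k : ℝ)⁻¹) (fun j ↦ (j : ℝ) / p) l ∂ρ ≤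
      2 * Real.pi ^ 2 * M / (k / p) + 2 * Real.pi ^ 2 / (b * (k / p)) ^ 2 * ρ.real Set.univ +
        ρ.real {l | Real.pi * p < |l|} := by
  have hk' : (0 : ℝ) < k := by exact_mod_cast hk
  have hp' : (0 : ℝ) < p := by exact_mod_cast hp
  have hπ := Real.pi_pos
  set L : ℝ := k / p with hL
  have hLpos : 0 < L := by positivity
  set g : ℝ → ℝ := fun l ↦ 2 * (1 + (L / Real.pi * l) ^ 2)⁻¹ with hg
  have hg0 : ∀ l, 0 ≤ g l := fun l ↦ by positivity
  have hgint : Integrable g volume :=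
    (integrable_inv_one_add_sq.comp_mul_left' (by positivity)).const_mul 2
  have hgval : ∫ l, g l = 2 * Real.pi ^ 2 / L := by
    rw [hg, integral_const_mul, Measure.integral_comp_mul_left (fun x ↦ (1 + x ^ 2)⁻¹),
      integral_univ_inv_one_add_sq, abs_of_pos (by positivity), smul_eq_mul]
    field_simp
  have hS : MeasurableSet {l : ℝ | Real.pi * p < |l|} :=
    measurableSet_lt (by fun_prop) (by fun_prop)
  have hsm : Integrable g (ENNReal.ofReal M • volume) := hgint.smul_measure ENNReal.ofReal_ne_top
  have hgρ : IntegrableOn g (Set.Ioo (-b) b) ρ := hsm.restrict.mono_measure hρ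
  have h1 : ∫ l in Set.Ioo (-b) b, g l ∂ρ ≤ 2 * Real.pi ^ 2 * M / L := by
    calc ∫ l in Set.Ioo (-b) b, g l ∂ρ ≤ ∫ l in Set.Ioo (-b) b, g l ∂(ENNReal.ofReal M • volume) :=
          integral_mono_measure hρ (.of_forall hg0) hsm.restrict
      _ ≤ ∫ l, g l ∂(ENNReal.ofReal M • volume) :=
          setIntegral_le_integral hsm (.of_forall hg0)
      _ = 2 * Real.pi ^ 2 * M / L := by
          rw [integral_smul_measure, hgval, ENNReal.toReal_ofReal hM, smul_eq_mul]
          ring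
  -- Beyond `π * p` aliasing destroys the decay of the kernel, so only the trivial bound `1` is used
  -- there.
  have hpt : ∀ l, trigEnergy (fun _ : Fin k ↦ (k : ℝ)⁻¹) (fun j ↦ (j : ℝ) / p) l ≤
      (Set.Ioo (-b) b).indicator g l + 2 * Real.pi ^ 2 / (b * L) ^ 2 +
        {l : ℝ | Real.pi * p < |l|}.indicator (1 : ℝ → ℝ) l := by
    intro l
    have hc : 0 ≤ 2 * Real.pi ^ 2 / (b * L) ^ 2 := by positivity
    have hi1 : 0 ≤ (Set.Ioo (-b) b).indicator g l := Set.indicator_nonneg (fun l _ ↦ hg0 l) l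
    have hi2 : (0 : ℝ) ≤ {l : ℝ | Real.pi * p < |l|}.indicator (1 : ℝ → ℝ) l :=
      Set.indicator_nonneg (fun _ _ ↦ by simp) l
    by_cases hl : Real.pi * p < |l|
    · have := trigEnergy_average_le_one hk (fun j ↦ (j : ℝ) / p) l
      have h2 : {l : ℝ | Real.pi * p < |l|}.indicator (1 : ℝ → ℝ) l = 1 :=
        Set.indicator_of_mem (s := {l : ℝ | Real.pi * p < |l|}) hl _
      linarith
    · have := trigEnergy_average_le hk hp (not_lt.1 hl)
      by_cases hlb : l ∈ Set.Ioo (-b) b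
      · rw [Set.indicator_of_mem hlb]
        change _ ≤ g l at this
        linarith
      · have hbl : b ≤ |l| := by
          by_contra! h
          exact hlb (abs_lt.1 h)
        have h3 : b ^ 2 ≤ l ^ 2 := by
          rw [← sq_abs l]
          gcongr
        have : 2 * (1 + (L / Real.pi * l) ^ 2)⁻¹ ≤ 2 * Real.pi ^ 2 / (b * L) ^ 2 := by
          have h4 : (b * L) ^ 2 / Real.pi ^ 2 ≤ 1 + (L / Real.pi * l) ^ 2 := by
            have : b ^ 2 * L ^ 2 / Real.pi ^ 2 ≤ l ^ 2 * L ^ 2 / Real.pi ^ 2 := by gcongr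
            rw [mul_pow, mul_pow, div_pow L, div_mul_eq_mul_div, mul_comm (L ^ 2)]
            linarith
          calc 2 * (1 + (L / Real.pi * l) ^ 2)⁻¹ ≤ 2 * ((b * L) ^ 2 / Real.pi ^ 2)⁻¹ := by gcongr
            _ = 2 * Real.pi ^ 2 / (b * L) ^ 2 := by rw [inv_div]; ring
        linarith
  have hI1 : Integrable ((Set.Ioo (-b) b).indicator g) ρ :=
    (integrable_indicator_iff measurableSet_Ioo).2 hgρ
  have hI2 : Integrable ({l : ℝ | Real.pi * p < |l|}.indicator (1 : ℝ → ℝ)) ρ :=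
    (integrable_const (1 : ℝ)).indicator hS
  refine (integral_mono (integrable_trigEnergy ρ _ _)
    ((hI1.add (integrable_const _)).add hI2) hpt).trans ?_
  have e1 := integral_add (hI1.add (integrable_const (2 * Real.pi ^ 2 / (b * L) ^ 2))) hI2
  have e2 := integral_add hI1 (integrable_const (μ := ρ) (2 * Real.pi ^ 2 / (b * L) ^ 2))
  simp only [Pi.add_apply] at e1 e2 ⊢
  rw [e1, e2, integral_indicator measurableSet_Ioo, integral_indicator_one hS, integral_const,
    smul_eq_mul, mul_comm (ρ.real _)]
  gcongr

/-! ### Sampled processes and their variances -/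

/-- `X` is a Gaussian sequence of constant mean whose second moments are those of a process
with spectral measure `ρ` sampled at the points `j / p`. -/
structure IsSampling {Ω : Type*} [MeasurableSpace Ω] (X : ℕ → Ω → ℝ) (P : Measure Ω)
    (ρ : Measure ℝ) (p : ℕ) (μ : ℝ) : Prop where
  gaussian : IsGaussianProcess X P
  mean : ∀ j, ∫ ω, X j ω ∂P = μ
  secondMoment : ∀ i j : ℕ,
    ∫ ω, X i ω * X j ω ∂P = ∫ l, Real.cos (l * ((i : ℝ) / p - (j : ℝ) / p)) ∂ρ

namespace IsSampling

variable {Ω : Type*} [MeasurableSpace Ω] {X : ℕ → Ω → ℝ} {P : Measure Ω} {ρ : Measure ℝ}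
  {p : ℕ} {μ : ℝ}

lemma memLp (h : IsSampling X P ρ p μ) (j : ℕ) : MemLp (X j) 2 P :=
  (h.gaussian.hasGaussianLaw_eval j).memLp_two

lemma hasGaussianLaw_comp (h : IsSampling X P ρ p μ) {ι : Type*} [Fintype ι] (u : ι → ℕ) :
    HasGaussianLaw (fun ω i ↦ X (u i) ω) P := by
  have := (h.gaussian.comp_right u).hasGaussianLaw Finset.univ
  let L : (↥(Finset.univ : Finset ι) → ℝ) →L[ℝ] ι → ℝ :=
    ContinuousLinearMap.pi fun i ↦ ContinuousLinearMap.proj ⟨i, Finset.mem_univ i⟩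
  exact this.map L

lemma hasGaussianLaw_sum (h : IsSampling X P ρ p μ) {ι : Type*} [Fintype ι] (u : ι → ℕ)
    (a : ι → ℝ) : HasGaussianLaw (fun ω ↦ ∑ i, a i * X (u i) ω) P := by
  let L : (ι → ℝ) →L[ℝ] ℝ := ∑ i, a i • ContinuousLinearMap.proj i
  have hL : (fun ω ↦ ∑ i, a i * X (u i) ω) = L ∘ fun ω i ↦ X (u i) ω := by
    ext ω
    simp [L]
  rw [hL]
  exact (h.hasGaussianLaw_comp u).map L

lemma integral_sum (h : IsSampling X P ρ p μ) {ι : Type*} [Fintype ι] (u : ι → ℕ)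
    (a : ι → ℝ) : ∫ ω, ∑ i, a i * X (u i) ω ∂P = (∑ i, a i) * μ := by
  rw [integral_finsetSum _ fun i _ ↦
    ((h.gaussian.hasGaussianLaw_eval (u i)).integrable).const_mul _]
  simp_rw [integral_const_mul, h.mean, Finset.sum_mul]

lemma integral_sq_sum [IsFiniteMeasure ρ] (h : IsSampling X P ρ p μ) {ι : Type*} [Fintype ι]
    (u : ι → ℕ) (a : ι → ℝ) :
    ∫ ω, (∑ i, a i * X (u i) ω) ^ 2 ∂P = ∫ l, trigEnergy a (fun i ↦ (u i : ℝ) / p) l ∂ρ :=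
  integral_sq_sum_eq_integral_trigEnergy (fun i ↦ h.memLp (u i))
    (fun i j ↦ h.secondMoment (u i) (u j)) a

lemma variance_sum [IsFiniteMeasure ρ] (h : IsSampling X P ρ p μ) {ι : Type*} [Fintype ι]
    (u : ι → ℕ) (a : ι → ℝ) :
    Var[fun ω ↦ ∑ i, a i * X (u i) ω; P] =
      ∫ l, trigEnergy a (fun i ↦ (u i : ℝ) / p) l ∂ρ - ((∑ i, a i) * μ) ^ 2 := by
  have := h.gaussian.isProbabilityMeasure
  rw [variance_eq_sub (h.hasGaussianLaw_sum u a).memLp_two, ← h.integral_sq_sum, h.integral_sum]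
  rfl

/-- Along an arithmetic progression of step `d` in the time set, the covariance is bounded from
below by the flat part of the spectral measure. -/
lemma variance_sum_arithmetic_ge [IsFiniteMeasure ρ] (h : IsSampling X P ρ p 0) (hp : 0 < p)
    {d : ℕ} (hd : 0 < d) {m : ℝ} (hm : 0 ≤ m)
    (hlow : (ENNReal.ofReal m • volume).restrict (Set.Ioo (-(Real.pi / d)) (Real.pi / d)) ≤
      ρ.restrict (Set.Ioo (-(Real.pi / d)) (Real.pi / d)))
    (s : ℕ) {n : ℕ} (a : Fin n → ℝ) :
    2 * (Real.pi / d) * m * ∑ i, a i ^ 2 ≤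
      Var[fun ω ↦ ∑ i : Fin n, a i * X (s + d * p * i) ω; P] := by
  have hp' : (0 : ℝ) < p := by exact_mod_cast hp
  have hd' : (0 : ℝ) < d := by exact_mod_cast hd
  have ht : (fun i : Fin n ↦ ((s + d * p * i : ℕ) : ℝ) / p) =
      fun i : Fin n ↦ (s : ℝ) / p + i * d := by
    ext i
    push_cast
    field_simp
  rw [h.variance_sum (fun i : Fin n ↦ s + d * p * i), ht, mul_zero, zero_pow two_ne_zero, sub_zero]
  set E := trigEnergy a fun i : Fin n ↦ (s : ℝ) / p + i * d
  have hE := integral_trigEnergy_arithmetic a ((s : ℝ) / p) hd'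
  -- Nonnegativity of the energy allows `ρ` to be replaced by its minorant on the flat interval,
  -- where Parseval is exact.
  calc 2 * (Real.pi / d) * m * ∑ i, a i ^ 2
      = ∫ l in Set.Ioo (-(Real.pi / d)) (Real.pi / d), E l ∂(ENNReal.ofReal m • volume) := by
        rw [Measure.restrict_smul, integral_smul_measure, hE, ENNReal.toReal_ofReal hm, smul_eq_mul]
        ring
    _ ≤ ∫ l in Set.Ioo (-(Real.pi / d)) (Real.pi / d), E l ∂ρ :=
        integral_mono_measure hlow (.of_forall (trigEnergy_nonneg _ _))
          (integrable_trigEnergy _ _ _)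
    _ ≤ ∫ l, E l ∂ρ :=
        setIntegral_le_integral (integrable_trigEnergy _ _ _) (.of_forall (trigEnergy_nonneg _ _))

end IsSampling

/-! ### Persistence of a sampled sequence -/

lemma lintegral_indicator_exp_neg {α : ℝ} (hα : 0 < α) :
    ∫⁻ x, (Set.Ioi (0 : ℝ)).indicator (fun x ↦ ENNReal.ofReal (Real.exp (-α * x))) x =
      ENNReal.ofReal α⁻¹ := by
  rw [lintegral_indicator measurableSet_Ioi, ← ofReal_integral_eq_lintegral_ofReal
    (integrableOn_exp_mul_Ioi (neg_lt_zero.2 hα) 0) (.of_forall fun x ↦ (Real.exp_pos _).le),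
    integral_exp_mul_Ioi (neg_lt_zero.2 hα)]
  simp

/-- If the average of the numbers `x i`, `i < n * q`, is at most `1 / α`, then the exponential
weights `exp (-α * ∑ x i)` over the residue classes modulo `q` have mean at least `exp (-n)`. -/
lemma one_le_exp_mul_sum_prod {n q : ℕ} (hn : 0 < n) (hq : 0 < q) {α : ℝ} (hα : 0 < α) {x : ℕ → ℝ}
    (hx : ∑ i : Fin (n * q), ((n * q : ℕ) : ℝ)⁻¹ * x i ≤ α⁻¹) :
    1 ≤ ∑ s : Fin q, Real.exp n * (q : ℝ)⁻¹ * ∏ j : Fin n, Real.exp (-α * x (s + q * j)) := by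
  have hn' : (0 : ℝ) < n := by exact_mod_cast hn
  have hq' : (0 : ℝ) < q := by exact_mod_cast hq
  have hsum : ∑ i : Fin (n * q), x i = ∑ s : Fin q, ∑ j : Fin n, x (s + q * j) := by
    rw [← Equiv.sum_comp finProdFinEquiv (fun i : Fin (n * q) ↦ x i), Fintype.sum_prod_type,
      Finset.sum_comm]
    simp [finProdFinEquiv]
  have hjensen := convexOn_exp.map_sum_le (t := Finset.univ) (w := fun _ : Fin q ↦ (q : ℝ)⁻¹)
    (p := fun s ↦ ∑ j : Fin n, -α * x (s + q * j)) (fun _ _ ↦ by positivity)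
    (by simp [hq'.ne']) (fun _ _ ↦ Set.mem_univ _)
  simp_rw [smul_eq_mul] at hjensen
  calc (1 : ℝ)
      ≤ Real.exp n * Real.exp (∑ s : Fin q, (q : ℝ)⁻¹ * ∑ j : Fin n, -α * x (s + q * j)) := by
        rw [← Real.exp_add]
        refine Real.one_le_exp ?_
        simp_rw [← Finset.mul_sum] at hx ⊢
        rw [hsum] at hx
        push_cast at hx
        set S := ∑ s : Fin q, ∑ j : Fin n, x (s + q * j)
        have h1 : (q : ℝ)⁻¹ * (α * S) ≤ n := by
          have := mul_le_mul_of_nonneg_left hx (by positivity : 0 ≤ α * n)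
          calc (q : ℝ)⁻¹ * (α * S) = α * n * ((n * q : ℝ)⁻¹ * S) := by field_simp
            _ ≤ _ := this
            _ = n := by field_simp
        linarith
    _ ≤ Real.exp n * ∑ s : Fin q, (q : ℝ)⁻¹ * Real.exp (∑ j : Fin n, -α * x (s + q * j)) := by
        gcongr
    _ = _ := by
        rw [Finset.mul_sum]
        exact Finset.sum_congr rfl fun s _ ↦ by rw [Real.exp_sum]; ring

/-- The exponential weight `α` for which `∫ x in Ioi 0, exp (-α * x)` is `exp (-2)` times the
reciprocal of the maximal density of a Gaussian of variance `2 * (π / d) * m`. -/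
noncomputable def flatWeight (d : ℕ) (m : ℝ) : ℝ :=
  Real.exp 2 / √(2 * Real.pi * (2 * (Real.pi / d) * m))

lemma flatWeight_pos {d : ℕ} (hd : 0 < d) {m : ℝ} (hm : 0 < m) : 0 < flatWeight d m := by
  have := Real.pi_pos
  unfold flatWeight
  positivity

namespace IsSampling

variable {Ω : Type*} [MeasurableSpace Ω] {X : ℕ → Ω → ℝ} {P : Measure Ω} {ρ : Measure ℝ} {p : ℕ}

/-- Markov's inequality for the exponential weights averaged over the residue classes modulo `d *
p`. Independence between classes is not needed, since only expectations are summed. -/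
lemma measure_pos_and_average_le [IsFiniteMeasure ρ] (h : IsSampling X P ρ p 0) (hp : 0 < p)
    {d : ℕ} (hd : 0 < d) {m : ℝ} (hm : 0 < m)
    (hlow : (ENNReal.ofReal m • volume).restrict (Set.Ioo (-(Real.pi / d)) (Real.pi / d)) ≤
      ρ.restrict (Set.Ioo (-(Real.pi / d)) (Real.pi / d))) {n : ℕ} (hn : 0 < n) :
    P {ω | (∀ j < n * (d * p), 0 < X j ω) ∧
      ∑ i : Fin (n * (d * p)), ((n * (d * p) : ℕ) : ℝ)⁻¹ * X i ω ≤ (flatWeight d m)⁻¹} ≤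
      ENNReal.ofReal (Real.exp (-n)) := by
  have hπ := Real.pi_pos
  set α := flatWeight d m with hα
  have hαpos : 0 < α := flatWeight_pos hd hm
  set q := d * p with hq
  have hqpos : 0 < q := Nat.mul_pos hd hp
  have hq' : (0 : ℝ) < q := by exact_mod_cast hqpos
  set F : ℝ → ENNReal := (Set.Ioi (0 : ℝ)).indicator fun x ↦ ENNReal.ofReal (Real.exp (-α * x))
    with hF
  have hFm : Measurable F := Measurable.indicator (by fun_prop) measurableSet_Ioi
  set w : ENNReal := ENNReal.ofReal (Real.exp n * (q : ℝ)⁻¹) with hw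
  have hXm : ∀ j, AEMeasurable (X j) P := h.gaussian.aemeasurable
  have hprodm : ∀ s : Fin q, AEMeasurable (fun ω ↦ ∏ j : Fin n, F (X (s + q * j) ω)) P := fun s ↦
    Finset.aemeasurable_fun_prod _ fun j _ ↦ hFm.comp_aemeasurable (hXm _)
  have hGm : AEMeasurable (fun ω ↦ ∑ s : Fin q, w * ∏ j : Fin n, F (X (s + q * j) ω)) P :=
    Finset.aemeasurable_fun_sum _ fun s _ ↦ (hprodm s).const_mul w
  have hsub : {ω | (∀ j < n * q, 0 < X j ω) ∧
      ∑ i : Fin (n * q), ((n * q : ℕ) : ℝ)⁻¹ * X i ω ≤ α⁻¹} ⊆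
      {ω | 1 ≤ ∑ s : Fin q, w * ∏ j : Fin n, F (X (s + q * j) ω)} := by
    rintro ω ⟨hpos, havg⟩
    have h1 := one_le_exp_mul_sum_prod (x := fun j ↦ X j ω) hn hqpos hαpos havg
    have hlt : ∀ (s : Fin q) (j : Fin n), (s : ℕ) + q * j < n * q := fun s j ↦ by
      have := (finProdFinEquiv (j, s)).2
      simpa [finProdFinEquiv] using this
    have h2 : ∀ (s : Fin q) (j : Fin n), F (X (s + q * j) ω) =
        ENNReal.ofReal (Real.exp (-α * X (s + q * j) ω)) := fun s j ↦
      Set.indicator_of_mem (Set.mem_Ioi.2 (hpos _ (hlt s j))) _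
    simp only [Set.mem_ofPred_eq, h2, hw]
    simp_rw [← ENNReal.ofReal_prod_of_nonneg fun j (_ : j ∈ Finset.univ) ↦ (Real.exp_pos _).le,
      ← ENNReal.ofReal_mul (by positivity : 0 ≤ Real.exp n * (q : ℝ)⁻¹)]
    rw [← ENNReal.ofReal_sum_of_nonneg fun s _ ↦ by positivity, ← ENNReal.ofReal_one]
    exact ENNReal.ofReal_le_ofReal h1
  have hcpos : 0 < 2 * (Real.pi / d) * m := by positivity
  set c : NNReal := (2 * (Real.pi / d) * m).toNNReal
  have hc : (c : ℝ) = 2 * (Real.pi / d) * m := Real.coe_toNNReal _ hcpos.le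
  have hc0 : c ≠ 0 := (Real.toNNReal_pos.2 hcpos).ne'
  -- Each point contributes the maximal density times `α⁻¹`, which is `exp (-2)` by the choice of
  -- `α`.
  have hcoset : ∀ s : Fin q, ∫⁻ ω, ∏ j : Fin n, F (X (s + q * j) ω) ∂P ≤
      ENNReal.ofReal (Real.exp (-2)) ^ n := by
    intro s
    refine (lintegral_prod_le_of_variance_ge (Y := fun (j : Fin n) ω ↦ X (s + q * j) ω)
      (h.hasGaussianLaw_comp fun j : Fin n ↦ s + q * j) hc0
      (fun a ↦ hc ▸ h.variance_sum_arithmetic_ge hp hd hm.le hlow s a) hFm).trans (le_of_eq ?_)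
    rw [hF, lintegral_indicator_exp_neg hαpos, Fintype.card_fin,
      ← ENNReal.ofReal_mul (by positivity)]
    congr 2
    rw [hα, flatWeight, inv_div, hc, Real.exp_neg]
    field_simp
  calc _ ≤ P {ω | 1 ≤ ∑ s : Fin q, w * ∏ j : Fin n, F (X (s + q * j) ω)} := measure_mono hsub
    _ ≤ ∫⁻ ω, ∑ s : Fin q, w * ∏ j : Fin n, F (X (s + q * j) ω) ∂P := by
        simpa using mul_meas_ge_le_lintegral₀ hGm 1
    _ = ∑ s : Fin q, w * ∫⁻ ω, ∏ j : Fin n, F (X (s + q * j) ω) ∂P := by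
        rw [lintegral_finsetSum' _ fun s _ ↦ (hprodm s).const_mul w]
        simp_rw [lintegral_const_mul' w _ ENNReal.ofReal_ne_top]
    _ ≤ ∑ s : Fin q, w * ENNReal.ofReal (Real.exp (-2)) ^ n := by
        gcongr with s
        exact hcoset s
    _ = ENNReal.ofReal (Real.exp (-n)) := by
        rw [Finset.sum_const, Finset.card_univ, Fintype.card_fin, nsmul_eq_mul, hw,
          ← ENNReal.ofReal_pow (Real.exp_pos _).le, ← ENNReal.ofReal_natCast,
          ← ENNReal.ofReal_mul (by positivity), ← ENNReal.ofReal_mul (by positivity),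
          ← Real.exp_nat_mul]
        congr 1
        rw [show (-n : ℝ) = n + n * (-2) by ring, Real.exp_add]
        field_simp

lemma measureReal_pos_le [IsFiniteMeasure ρ] (h : IsSampling X P ρ p 0) (hp : 0 < p)
    {d : ℕ} (hd : 0 < d) {m : ℝ} (hm : 0 < m)
    (hlow : (ENNReal.ofReal m • volume).restrict (Set.Ioo (-(Real.pi / d)) (Real.pi / d)) ≤
      ρ.restrict (Set.Ioo (-(Real.pi / d)) (Real.pi / d))) {n : ℕ} (hn : 0 < n) {V : ℝ} (hV : 0 < V)
    (hvar : ∫ l, trigEnergy (fun _ : Fin (n * (d * p)) ↦ ((n * (d * p) : ℕ) : ℝ)⁻¹)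
      (fun j ↦ (j : ℝ) / p) l ∂ρ ≤ V) :
    P.real {ω | ∀ j < n * (d * p), 0 < X j ω} ≤
      Real.exp (-((flatWeight d m)⁻¹ ^ 2 / (2 * V))) + Real.exp (-n) := by
  have := h.gaussian.isProbabilityMeasure
  set k := n * (d * p) with hk
  set K := (flatWeight d m)⁻¹ with hKdef
  have hK : 0 ≤ K := (inv_pos.2 (flatWeight_pos hd hm)).le
  set a : Fin k → ℝ := fun _ ↦ (k : ℝ)⁻¹
  have h1 := measureReal_ge_le_of_variance_le (K := K) (h.hasGaussianLaw_sum (fun i : Fin k ↦ i) a)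
    ((h.integral_sum _ _).trans (mul_zero _)) hV hK (by
      rw [h.variance_sum]
      simpa using hvar)
  have h2 : P.real {ω | (∀ j < k, 0 < X j ω) ∧ ∑ i : Fin k, a i * X i ω ≤ K} ≤
      Real.exp (-n) :=
    ENNReal.toReal_le_of_le_ofReal (Real.exp_pos _).le
      (h.measure_pos_and_average_le hp hd hm hlow hn)
  refine (measureReal_mono ?_).trans ((measureReal_union_le _ _).trans (add_le_add h1 h2))
  intro ω hω
  rcases le_total K (∑ i : Fin k, a i * X i ω) with hle | hle
  · exact Or.inl hle
  · exact Or.inr ⟨hω, hle⟩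

/-- The variance of the average is its second moment minus `μ ^ 2`, and is nonnegative. -/
lemma sq_mean_le [IsFiniteMeasure ρ] {μ : ℝ} (h : IsSampling X P ρ p μ) {k : ℕ} (hk : 0 < k) :
    μ ^ 2 ≤ ∫ l, trigEnergy (fun _ : Fin k ↦ (k : ℝ)⁻¹) (fun j ↦ (j : ℝ) / p) l ∂ρ := by
  have := variance_nonneg (fun ω ↦ ∑ i : Fin k, (k : ℝ)⁻¹ * X i ω) P
  rw [h.variance_sum (fun i : Fin k ↦ (i : ℕ)) fun _ ↦ (k : ℝ)⁻¹] at this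
  have hk' : (k : ℝ) ≠ 0 := by exact_mod_cast hk.ne'
  simp only [Finset.sum_const, Finset.card_univ, Fintype.card_fin, nsmul_eq_mul,
    mul_inv_cancel₀ hk', one_mul] at this
  linarith

end IsSampling

/-! ### Centring and the exponential rate -/

/-- The exponential rate obtained from a spectral density between `m` and `M` on
`(-π / d, π / d)`. -/
noncomputable def persistenceRate (d : ℕ) (m M : ℝ) : ℝ :=
  min ((flatWeight d m)⁻¹ ^ 2 * d / (2 * (2 * Real.pi ^ 2 * M + 2))) 1 / (2 * d)

lemma persistenceRate_pos {d : ℕ} (hd : 0 < d) {m M : ℝ} (hm : 0 < m) (hM : 0 < M) :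
    0 < persistenceRate d m M := by
  have := flatWeight_pos hd hm
  have hd' : (0 : ℝ) < d := by exact_mod_cast hd
  unfold persistenceRate
  have : 0 < min ((flatWeight d m)⁻¹ ^ 2 * d / (2 * (2 * Real.pi ^ 2 * M + 2))) 1 :=
    lt_min (by positivity) one_pos
  positivity

section

variable {Ω : Type*} [MeasurableSpace Ω] {P : Measure Ω} {ρ : Measure ℝ} [IsFiniteMeasure ρ]

/-- A stationary process without spectral mass at zero is centred. -/
lemma mean_eq_zero_of_forall_exists_isSampling {b M μ : ℝ} (hb : 0 < b) (hM : 0 ≤ M)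
    (hup : ρ.restrict (Set.Ioo (-b) b) ≤ (ENNReal.ofReal M • volume).restrict (Set.Ioo (-b) b))
    (hX : ∀ ε > 0, ∃ p : ℕ, 0 < p ∧ ρ.real {l | Real.pi * p < |l|} ≤ ε ∧
      ∃ X : ℕ → Ω → ℝ, IsSampling X P ρ p μ) : μ = 0 := by
  have key : ∀ n : ℕ, μ ^ 2 ≤ 2 * Real.pi ^ 2 * M * (1 / ((n : ℝ) + 1)) +
      2 * Real.pi ^ 2 / b ^ 2 * ρ.real Set.univ * (1 / ((n : ℝ) + 1)) ^ 2 + 1 / ((n : ℝ) + 1) := by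
    intro n
    -- The window has length `n + 1`, and `p` is chosen after `n`, so all three variance
    -- contributions tend to zero.
    obtain ⟨p, hp, htail, X, hXs⟩ := hX (1 / ((n : ℝ) + 1)) (by positivity)
    have hp' : (0 : ℝ) < p := by exact_mod_cast hp
    have hk : 0 < (n + 1) * p := by positivity
    refine (hXs.sq_mean_le hk).trans
      ((integral_trigEnergy_average_le hb hM hup hk hp).trans ?_)
    have : (((n + 1) * p : ℕ) : ℝ) / p = n + 1 := by
      push_cast
      field_simp
    rw [this]
    refine add_le_add (le_of_eq ?_) htail
    field_simp
  have hlim := tendsto_one_div_add_atTop_nhds_zero_nat (𝕜 := ℝ)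
  have := ge_of_tendsto' (((hlim.const_mul (2 * Real.pi ^ 2 * M)).add
    ((hlim.pow 2).const_mul (2 * Real.pi ^ 2 / b ^ 2 * ρ.real Set.univ))).add hlim) key
  have h0 : μ ^ 2 ≤ 0 := by simpa using this
  exact pow_eq_zero_iff two_ne_zero |>.1 (le_antisymm h0 (sq_nonneg _))

/-- A function dominated by the persistence probabilities of arbitrarily fine samplings decays
exponentially. -/
theorem eventually_le_exp_of_forall_exists_isSampling {d : ℕ} (hd : 0 < d) {m M μ : ℝ} (hm : 0 < m)
    (hM : 0 < M)
    (hlow : (ENNReal.ofReal m • volume).restrict (Set.Ioo (-(Real.pi / d)) (Real.pi / d)) ≤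
      ρ.restrict (Set.Ioo (-(Real.pi / d)) (Real.pi / d)))
    (hup : ρ.restrict (Set.Ioo (-(Real.pi / d)) (Real.pi / d)) ≤
      (ENNReal.ofReal M • volume).restrict (Set.Ioo (-(Real.pi / d)) (Real.pi / d)))
    {H : ℝ → ℝ} (hH : ∀ ε > 0, ∃ p : ℕ, 0 < p ∧ ρ.real {l | Real.pi * p < |l|} ≤ ε ∧
      ∃ X : ℕ → Ω → ℝ, IsSampling X P ρ p μ ∧
        ∀ (N : ℝ) (k : ℕ), (k : ℝ) ≤ p * N → H N ≤ P.real {ω | ∀ j < k, 0 < X j ω}) :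
    ∀ᶠ N : ℝ in atTop, H N ≤ Real.exp (-persistenceRate d m M * N) := by
  have hd' : (0 : ℝ) < d := by exact_mod_cast hd
  have hb : 0 < Real.pi / d := div_pos Real.pi_pos hd'
  have hμ : μ = 0 := mean_eq_zero_of_forall_exists_isSampling hb hM.le hup fun ε hε ↦ by
    obtain ⟨p, hp, htail, X, hXs, -⟩ := hH ε hε
    exact ⟨p, hp, htail, X, hXs⟩
  subst hμ
  -- For a window of length `n * d`, the flat frequencies contribute `2 * π ^ 2 * M` to `B`, the
  -- intermediate ones and the tail at most `1` each.
  set B := 2 * Real.pi ^ 2 * M + 2 with hB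
  have hBpos : 0 < B := by positivity
  set K := (flatWeight d m)⁻¹ with hK
  have hKpos : 0 < K := inv_pos.2 (flatWeight_pos hd hm)
  set κ := min (K ^ 2 * d / (2 * B)) 1 with hκ
  have hκpos : 0 < κ := lt_min (by positivity) one_pos
  set R := 2 * Real.pi ^ 2 / (Real.pi / d) ^ 2 * ρ.real Set.univ with hR
  -- The thresholds ensure respectively `R ≤ n * d`, `n ≥ 1`, and room to absorb a factor `2` and
  -- the rounding of `N / d`.
  filter_upwards [eventually_ge_atTop (R + d), eventually_ge_atTop (2 * d : ℝ),
    eventually_ge_atTop (2 * d * (1 + κ) / κ)] with N hN1 hN2 hN3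
  set n := ⌊N / d⌋₊ with hn
  have hN0 : 0 ≤ N / d := div_nonneg (by linarith) hd'.le
  have hnle : (n : ℝ) ≤ N / d := Nat.floor_le hN0
  have hnge : N / d < n + 1 := Nat.lt_floor_add_one _
  have hnpos : 0 < n := Nat.floor_pos.2 (by rw [le_div_iff₀ hd']; linarith)
  have hn' : (0 : ℝ) < n := by exact_mod_cast hnpos
  have hLpos : (0 : ℝ) < n * d := by positivity
  have hLN : (n : ℝ) * d ≤ N := by rwa [le_div_iff₀ hd'] at hnle
  have hRL : R ≤ n * d := by
    rw [div_lt_iff₀ hd'] at hnge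
    linarith
  obtain ⟨p, hp, htail, X, hXs, hHN⟩ := hH (1 / (n * d)) (by positivity)
  have hp' : (0 : ℝ) < p := by exact_mod_cast hp
  have hk : 0 < n * (d * p) := by positivity
  have hvar := integral_trigEnergy_average_le hb hM.le hup hk hp
  have hLk : ((n * (d * p) : ℕ) : ℝ) / p = n * d := by
    push_cast
    field_simp
  rw [hLk] at hvar
  have hmid : 2 * Real.pi ^ 2 / (Real.pi / d * (n * d)) ^ 2 * ρ.real Set.univ ≤ 1 / (n * d) := by
    rw [le_div_iff₀ hLpos]
    have : 2 * Real.pi ^ 2 / (Real.pi / d * (n * d)) ^ 2 * ρ.real Set.univ * (n * d) =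
        R / (n * d) := by
      rw [hR]
      field_simp
    rw [this]
    exact div_le_one_of_le₀ hRL hLpos.le
  have hV : ∫ l, trigEnergy (fun _ : Fin (n * (d * p)) ↦ ((n * (d * p) : ℕ) : ℝ)⁻¹)
      (fun j ↦ (j : ℝ) / p) l ∂ρ ≤ B / (n * d) := by
    have : B / (n * d) = 2 * Real.pi ^ 2 * M / (n * d) + 1 / (n * d) + 1 / (n * d) := by
      rw [hB]
      ring
    linarith
  have hmain := hXs.measureReal_pos_le hp hd hm hlow hnpos (div_pos hBpos hLpos) hV
  have h1 : H N ≤ P.real {ω | ∀ j < n * (d * p), 0 < X j ω} := hHN N _ (by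
    push_cast
    nlinarith)
  have h2 : Real.exp (-(K ^ 2 / (2 * (B / (n * d))))) ≤ Real.exp (-(κ * n)) := by
    rw [Real.exp_le_exp, neg_le_neg_iff]
    calc κ * n ≤ K ^ 2 * d / (2 * B) * n := by gcongr; exact min_le_left _ _
      _ = _ := by field_simp
  have h3 : Real.exp (-(n : ℝ)) ≤ Real.exp (-(κ * n)) := by
    rw [Real.exp_le_exp, neg_le_neg_iff]
    exact mul_le_of_le_one_left hn'.le (min_le_right _ _)
  have h4 : H N ≤ 2 * Real.exp (-(κ * n)) := by linarith
  refine h4.trans ?_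
  have h5 : (2 : ℝ) ≤ Real.exp 1 := by
    have := Real.add_one_le_exp (1 : ℝ)
    linarith
  calc 2 * Real.exp (-(κ * n)) ≤ Real.exp 1 * Real.exp (-(κ * n)) := by gcongr
    _ = Real.exp (1 - κ * n) := by rw [← Real.exp_add]; ring_nf
    -- Half of the exponent `κ * (N / d)` is given up to pay for `1 + κ`: the factor `2 ≤ exp 1` and
    -- the loss `n > N / d - 1`.
    _ ≤ Real.exp (-persistenceRate d m M * N) := by
      rw [Real.exp_le_exp]
      have e : persistenceRate d m M * N = κ * (N / d) / 2 := by
        rw [persistenceRate, ← hB, ← hK, ← hκ]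
        field_simp
      have h6 : κ * (N / d) ≤ κ * (n + 1) := by gcongr
      have h7 : 2 * (1 + κ) ≤ κ * (N / d) := by
        rw [div_le_iff₀ hκpos] at hN3
        rw [← mul_div_assoc, le_div_iff₀ hd']
        linarith
      rw [neg_mul, e]
      linarith

end

/-! ### From stationary processes to samplings -/

section StationaryProcess

variable {Ω : Type*} [MeasurableSpace Ω] {T : Type} {P : Measure Ω}
  {f : T → Ω → ℝ} {ρ : Measure ℝ}

lemma IsGaussianStationary.integral_eq [AddCommGroup T] [TopologicalSpace T]
    (hf : IsGaussianStationary f P) (t : T) :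
    ∫ ω, f t ω ∂P = ∫ ω, f 0 ω ∂P := by
  have := (hf.stationary t 1 fun _ ↦ 0).comp (u := fun x : Fin 1 → ℝ ↦ x 0) (by fun_prop)
  simpa [Function.comp_def] using this.integral_eq

lemma IsGaussianStationary.integral_mul_eq [AddCommGroup T] [TopologicalSpace T]
    (hf : IsGaussianStationary f P) (s t : T) :
    ∫ ω, f s ω * f t ω ∂P = covarianceFn f P (s - t) := by
  -- Shifting the pair `(0, s - t)` by `t` gives `(t, s)`.
  have := (hf.stationary t 2 ![0, s - t]).comp (u := fun x : Fin 2 → ℝ ↦ x 0 * x 1) (by fun_prop)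
  simpa [Function.comp_def, covarianceFn, mul_comm] using this.integral_eq

lemma IsSpectralMeasure.covarianceFn_eq [Zero T] [TimeSet T]
    (hρ : IsSpectralMeasure f P ρ) (t : T) :
    covarianceFn f P t = ∫ l, Real.cos (l * TimeSet.toReal t) ∂ρ := by
  have := hρ.finite
  have hI : Integrable (fun l : ℝ ↦
      Complex.exp (-(Complex.I * (l : ℂ) * (TimeSet.toReal t : ℂ)))) ρ := by
    refine Integrable.of_bound (by fun_prop : Continuous _).aestronglyMeasurable 1
      (.of_forall fun l ↦ ?_)
    rw [Complex.norm_exp]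
    simp
  have h := congrArg Complex.re (hρ.fourier t)
  rw [Complex.ofReal_re, ← RCLike.re_eq_complex_re, ← integral_re hI] at h
  rw [h]
  congr 1 with l
  simp [Complex.exp_re]

lemma isSampling_comp [AddCommGroup T] [TopologicalSpace T] [TimeSet T]
    (hf : IsGaussianStationary f P)   (hρ : IsSpectralMeasure f P ρ) {p : ℕ} {u : ℕ → T}
    (hu : ∀ i j, TimeSet.toReal (u i - u j) = (i : ℝ) / p - (j : ℝ) / p) :
    IsSampling (fun j ↦ f (u j)) P ρ p (∫ ω, f 0 ω ∂P) where
  gaussian := hf.gaussian.comp_right u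
  mean j := hf.integral_eq (u j)
  secondMoment i j := by rw [hf.integral_mul_eq, hρ.covarianceFn_eq, hu]

lemma gapProbability_le [TimeSet T] [IsFiniteMeasure P] {p : ℕ} (hp : 0 < p) {u : ℕ → T}
    (hu : ∀ j, TimeSet.toReal (u j) = (j : ℝ) / p) (N : ℝ) (k : ℕ) (hk : (k : ℝ) ≤ p * N) :
    gapProbability f P N ≤ P.real {ω | ∀ j < k, 0 < f (u j) ω} := by
  refine measureReal_mono fun ω hω j hj ↦ hω _ ?_
  have hp' : (0 : ℝ) < p := by exact_mod_cast hp
  rw [hu]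
  refine ⟨by positivity, ?_⟩
  rw [div_lt_iff₀ hp', mul_comm]
  exact lt_of_lt_of_le (by exact_mod_cast hj) hk

/-- Closed balls of the line are intervals, so the hypothesis supplies exactly what the covering
argument needs. -/
lemma ComparableNearZero.restrict_le [TimeSet T] [IsFiniteMeasure ρ] {a m M b : ℝ}
    (h : ComparableNearZero T ρ a m M)
    (hb : Set.Ioo (-b) b ⊆ Set.Ioo (-a) a ∩ TimeSet.dual T) :
    (ENNReal.ofReal m • volume).restrict (Set.Ioo (-b) b) ≤ ρ.restrict (Set.Ioo (-b) b) ∧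
      ρ.restrict (Set.Ioo (-b) b) ≤ (ENNReal.ofReal M • volume).restrict (Set.Ioo (-b) b) := by
  have hI : ∀ x r, Metric.closedBall x r ⊆ Set.Ioo (-b) b →
      ENNReal.ofReal m * volume (Metric.closedBall x r) ≤ ρ (Metric.closedBall x r) ∧
        ρ (Metric.closedBall x r) ≤ ENNReal.ofReal M * volume (Metric.closedBall x r) :=
    fun x r hr ↦ h _ (by rw [Real.closedBall_eq_Icc]; exact Set.ordConnected_Icc) (hr.trans hb)
  have : IsLocallyFiniteMeasure (ENNReal.ofReal M • (volume : Measure ℝ)) :=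
    inferInstanceAs (IsLocallyFiniteMeasure (M.toNNReal • (volume : Measure ℝ)))
  exact ⟨restrict_le_restrict_of_forall_closedBall_le isOpen_Ioo fun x r hr ↦ (hI x r hr).1,
    restrict_le_restrict_of_forall_closedBall_le isOpen_Ioo fun x r hr ↦ (hI x r hr).2⟩

end StationaryProcess

lemma exists_measureReal_abs_gt_le (ρ : Measure ℝ) [IsFiniteMeasure ρ] {ε : ℝ} (hε : 0 < ε) :
    ∃ p : ℕ, 0 < p ∧ ρ.real {l | Real.pi * p < |l|} ≤ ε := by
  have hanti : Antitone fun p : ℕ ↦ {l : ℝ | Real.pi * p < |l|} := fun p q hpq l hl ↦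
    lt_of_le_of_lt (mul_le_mul_of_nonneg_left (Nat.cast_le.2 hpq) Real.pi_pos.le) hl
  have hempty : ⋂ p : ℕ, {l : ℝ | Real.pi * p < |l|} = ∅ := by
    ext l
    simp only [Set.mem_iInter, Set.mem_ofPred_eq, Set.mem_empty_iff_false, iff_false, not_forall,
      not_lt]
    obtain ⟨p, hp⟩ := exists_nat_ge (|l| / Real.pi)
    exact ⟨p, by rwa [div_le_iff₀' Real.pi_pos] at hp⟩
  have hlim := tendsto_measure_iInter_atTop (μ := ρ)
    (fun p : ℕ ↦ (measurableSet_lt (by fun_prop) (by fun_prop) :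
      MeasurableSet {l : ℝ | Real.pi * p < |l|}).nullMeasurableSet) hanti ⟨0, measure_ne_top _ _⟩
  rw [hempty, measure_empty] at hlim
  have hev := hlim.eventually (Iic_mem_nhds (ENNReal.ofReal_pos.2 hε))
  obtain ⟨p, hp, hp0⟩ := (hev.and (eventually_gt_atTop 0)).exists
  exact ⟨p, hp0, ENNReal.toReal_le_of_le_ofReal hε.le hp⟩

lemma eventually_gapProbability_int_le {Ω : Type*} [MeasurableSpace Ω] {P : Measure Ω}
    [IsProbabilityMeasure P] {f : ℤ → Ω → ℝ} {ρ : Measure ℝ} (hf : IsGaussianStationary f P)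
    (hρ : IsSpectralMeasure f P ρ) {a m M : ℝ} (hm : 0 < m) (hM : 0 < M)
    (hcomp : ComparableNearZero ℤ ρ a m M) {d : ℕ} (hd : 0 < d) (hda : Real.pi / d ≤ a) :
    ∀ᶠ N : ℝ in atTop, gapProbability f P N ≤ Real.exp (-persistenceRate d m M * N) := by
  have := hρ.finite
  have hdπ : Real.pi / d ≤ Real.pi := div_le_self Real.pi_pos.le (by exact_mod_cast hd)
  obtain ⟨hlow, hup⟩ := hcomp.restrict_le (Set.subset_inter
    (Set.Ioo_subset_Ioo (neg_le_neg hda) hda)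
    (Set.Ioo_subset_Icc_self.trans (Set.Icc_subset_Icc (neg_le_neg hdπ) hdπ)))
  -- On `ℤ` the step `1` suffices for every `ε`, as no spectral mass lies beyond `π`.
  refine eventually_le_exp_of_forall_exists_isSampling hd hm hM hlow hup fun ε hε ↦
    ⟨1, one_pos, ?_, fun j ↦ f j, isSampling_comp hf hρ fun i j ↦ ?_,
      gapProbability_le one_pos fun j ↦ ?_⟩
  · have h0 : ρ {l | Real.pi * (1 : ℕ) < |l|} = 0 := by
      refine measure_mono_null (t := (TimeSet.dual ℤ)ᶜ) (fun l hl hmem ↦ ?_) hρ.carried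
      have : |l| ≤ Real.pi := abs_le.2 hmem
      simp only [Nat.cast_one, mul_one, Set.mem_ofPred_eq] at hl
      linarith
    rw [measureReal_def, h0]
    exact hε.le
  · change (((i : ℤ) - (j : ℤ) : ℤ) : ℝ) = _
    simp
  · change ((j : ℤ) : ℝ) = _
    simp

lemma eventually_gapProbability_real_le {Ω : Type*} [MeasurableSpace Ω] {P : Measure Ω}
    [IsProbabilityMeasure P] {f : ℝ → Ω → ℝ} {ρ : Measure ℝ} (hf : IsGaussianStationary f P)
    (hρ : IsSpectralMeasure f P ρ) {a m M : ℝ} (hm : 0 < m) (hM : 0 < M)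
    (hcomp : ComparableNearZero ℝ ρ a m M) {d : ℕ} (hd : 0 < d) (hda : Real.pi / d ≤ a) :
    ∀ᶠ N : ℝ in atTop, gapProbability f P N ≤ Real.exp (-persistenceRate d m M * N) := by
  have := hρ.finite
  obtain ⟨hlow, hup⟩ := hcomp.restrict_le (Set.subset_inter
    (Set.Ioo_subset_Ioo (neg_le_neg hda) hda) (Set.subset_univ _))
  refine eventually_le_exp_of_forall_exists_isSampling (P := P) (μ := ∫ ω, f 0 ω ∂P) hd hm hM
    hlow hup fun ε hε ↦ ?_
  obtain ⟨p, hp, htail⟩ := exists_measureReal_abs_gt_le ρ hε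
  exact ⟨p, hp, htail, fun j ↦ f (j / p),
    isSampling_comp (u := fun j ↦ (j : ℝ) / p) hf hρ fun i j ↦ rfl,
    gapProbability_le (u := fun j ↦ (j : ℝ) / p) hp fun j ↦ rfl⟩

end GaussianPersistence

theorem theorem1 (a m M : ℝ) (ha : 0 < a) (hm : 0 < m) (hM : 0 < M) :
    ∃ C : ℝ, 0 < C ∧
      (∀ (Ω : Type*) [MeasurableSpace Ω] (P : Measure Ω) [IsProbabilityMeasure P]
        (f : ℤ → Ω → ℝ) (ρ : Measure ℝ),
        GaussianPersistence.IsGaussianStationary f P →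
        GaussianPersistence.IsSpectralMeasure f P ρ →
        GaussianPersistence.MomentCondition ρ →
        GaussianPersistence.ComparableNearZero ℤ ρ a m M →
        ∀ᶠ N : ℝ in atTop,
          GaussianPersistence.gapProbability f P N ≤ Real.exp (-C * N)) ∧
      (∀ (Ω : Type*) [MeasurableSpace Ω] (P : Measure Ω) [IsProbabilityMeasure P]
        (f : ℝ → Ω → ℝ) (ρ : Measure ℝ),
        GaussianPersistence.IsGaussianStationary f P →
        GaussianPersistence.IsSpectralMeasure f P ρ →
        GaussianPersistence.MomentCondition ρ →
        GaussianPersistence.ComparableNearZero ℝ ρ a m M →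
        ∀ᶠ N : ℝ in atTop,
          GaussianPersistence.gapProbability f P N ≤ Real.exp (-C * N)) := by
  -- An integer `d` makes step `d` admissible in `ℤ` and keeps `π / d ≤ π`; depending on `a` alone,
  -- it gives both time sets the same constant.
  obtain ⟨d, hd⟩ := exists_nat_ge (Real.pi / a)
  have hd' : (0 : ℝ) < d := (div_pos Real.pi_pos ha).trans_le hd
  have hd0 : 0 < d := by exact_mod_cast hd'
  have hda : Real.pi / d ≤ a := by rwa [div_le_comm₀ hd' ha]
  exact ⟨GaussianPersistence.persistenceRate d m M,
    GaussianPersistence.persistenceRate_pos hd0 hm hM,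
    fun _ _ _ _ _ _ hf hρ _ hcomp ↦
      GaussianPersistence.eventually_gapProbability_int_le hf hρ hm hM hcomp hd0 hda,
    fun _ _ _ _ _ _ hf hρ _ hcomp ↦
      GaussianPersistence.eventually_gapProbability_real_le hf hρ hm hM hcomp hd0 hda⟩
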